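/- Let $m \ge 2$ be an integer, $t \ge 0$ and $\lambda > 0$. A target lies on one of $m$ rays extending from the origin, at an unknown distance $D \ge \lambda$ from the origin. A search strategy is a sequence $(x_i, r_i)_{i\ge 1}$, where $x_i \ge 0$ and $r_i$ is one of the rays, such that for every ray $r$ the distances $x_i$ with $r_i = r$ are unbounded. At step $i$ the searcher starts at the origin and walks the distance $x_i$ on the ray $r_i$; he finds the target if it lies on $r_i$ and $D \le x_i$, and otherwise he turns and walks back to the origin. If the target is found at step $n$ for the first time, the cost of the search is the distance travelled plus $t$ for each turn, that is, $\sum_{j=1}^{n-1} (2x_j + t) + D$. The competitive cost of a strategy is the supremum of the ratio of the cost to $D$ over all targets on the $m$ rays with $D \ge \lambda$. A strategy is optimal if its competitive cost is the least among all search strategies. A strategy is periodic if $r_1, \dots, r_m$ are pairwise distinct and $r_{i+m} = r_i$ for all $i \ge 1$. (1) If $\frac{t}{2\lambda} \le \frac{1}{\left(\frac{m}{m-1}\right)^{m-1} - 1}$, then every periodic sequence $(x_i, r_i)_{i\ge1}$ with $$x_i = \left(\left(\frac{1}{m-1}\left(1 - \left(\left(\frac{m}{m-1}\right)^{m-1}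 - 1\right)\frac{t}{2\lambda}\right) i + \left(1 + \frac{t}{2\lambda}\right)\right)\left(\frac{m}{m-1}\right)^i - \frac{t}{2\lambda}\right)\lambda \qquad (i \ge 1)$$ is an optimal search strategy and has competitive cost $1 + 2\frac{m^m}{(m-1)^{m-1}}$. (2) If $\frac{t}{2\lambda} \ge \frac{1}{\left(\frac{m}{m-1}\right)^{m-1} - 1}$, then every periodic sequence $(x_i, r_i)_{i\ge1}$ with $$x_i = \left(\left(1 + \frac{t}{2\lambda}\right)\left(1 + \left(\frac{t}{2\lambda}\right)^{-1}\right)^{\frac{i}{m-1}} - \frac{t}{2\lambda}\right)\lambda \qquad (i \ge 1)$$ is a search strategy and has competitive cost $$\frac{\left(1 + \left(\frac{t}{2\lambda}\right)^{-1}\right)^{\frac{-1}{m-1}} - \left(3 + 2\left(\frac{t}{2\lambda}\right)^{-1}\right)}{\left(1 + \left(\frac{t}{2\lambda}\right)^{-1}\right)^{\frac{-1}{m-1}} - 1}.$$ -/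

import Mathlib

namespace RaySearch

/-- Data of a strategy on `m` rays: at step `i` (steps are numbered from `1`, the value at `0` is
never used) the searcher walks the distance `(S i).1` on the ray `(S i).2` and, if the target has
not been found, walks back to the origin. -/
abbrev Strategy (m : ℕ) : Type := ℕ → ℝ × Fin m

/-- The walked distances are non-negative, and they are unbounded on every ray. -/
def IsSearchStrategy {m : ℕ} (S : Strategy m) : Prop :=
  (∀ i, 1 ≤ i → 0 ≤ (S i).1) ∧
    ∀ ρ : Fin m, ¬ BddAbove {d : ℝ | ∃ i, 1 ≤ i ∧ (S i).2 = ρ ∧ (S i).1 = d}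

/-- The rays are visited cyclically: the first `m` steps use pairwise different rays, and the same
order is repeated forever. -/
def IsPeriodic {m : ℕ} (S : Strategy m) : Prop :=
  (∀ i j, 1 ≤ i → i ≤ m → 1 ≤ j → j ≤ m → (S i).2 = (S j).2 → i = j) ∧
    ∀ i, 1 ≤ i → (S (i + m)).2 = (S i).2

/-- The target at distance `D` on the ray `ρ` is reached during step `i`. -/
def FindsAt {m : ℕ} (S : Strategy m) (ρ : Fin m) (D : ℝ) (i : ℕ) : Prop :=
  1 ≤ i ∧ (S i).2 = ρ ∧ D ≤ (S i).1

open Classical in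
/-- The cost, with turn cost `t`, of finding the target at distance `D` on the ray `ρ`: each
unsuccessful step `j` costs `2 x_j + t` (way out, one turn, way back), and the first successful
step costs `D`. The cost is `⊤` if the target is never found. -/
noncomputable def searchCost {m : ℕ} (t : ℝ) (S : Strategy m) (ρ : Fin m) (D : ℝ) : EReal :=
  if h : ∃ i, FindsAt S ρ D i then
    (((∑ j ∈ Finset.Ico 1 (Nat.find h), (2 * (S j).1 + t)) + D : ℝ) : EReal)
  else ⊤

/-- The competitive cost: the supremum of the search cost divided by the distance `D` of the
target, over all targets at distance at least `lam` from the origin. -/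
noncomputable def competitiveCost {m : ℕ} (t lam : ℝ) (S : Strategy m) : EReal :=
  ⨆ (ρ : Fin m) (D : ℝ) (_ : lam ≤ D), searchCost t S ρ D / (D : EReal)

/-- `S` is a search strategy whose competitive cost is least among all search strategies. -/
def IsOptimal {m : ℕ} (t lam : ℝ) (S : Strategy m) : Prop :=
  IsSearchStrategy S ∧
    ∀ S' : Strategy m, IsSearchStrategy S' → competitiveCost t lam S ≤ competitiveCost t lam S'

end RaySearch

namespace RaySearch

open Filter Topology

/-! ### Evaluating the search cost -/

/-! Write `s = t / (2 * lam)`. The worst targets lie just beyond a previous turning point, so a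
periodic strategy costs `1 + 2K` once the distance and turns before step `m + k` cost `2K x_k` for
every `k ≥ 0`, with `x_0 = lam` (`IsPeriodic.competitiveCost_eq`). For `y_i = x_i + s * lam` this
gives `y_{m+k} = K (y_{k+1} - y_k)`, with characteristic equation `z^m = K (z - 1)`. The least `K`
with a root `z > 1` is `m^m / (m-1)^(m-1)`, where `z = m / (m-1)` is a double root: hence the linear
factor in (1). In (2) a single geometric term is used.

Optimality in (1) holds because this value bounds every strategy from below, even without turn costs
(`le_competitiveCost`). If the cost is at most `1 + 2c`, the total depth `T` is at most `c` times
every frontier, so `potential` stays above `1 / c^m`. By AM-GM each step that advances a frontier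
multiplies it by at most `δ = c (m-1)^(m-1) / m^m`, and no other step increases it. If `δ < 1`,
infinitely many advances contradict the lower bound. -/

lemma searchCost_eq_of_first {m : ℕ} {t : ℝ} {S : Strategy m} {ρ : Fin m} {D : ℝ} {n : ℕ}
    (hn : FindsAt S ρ D n) (hlt : ∀ j < n, ¬ FindsAt S ρ D j) :
    searchCost t S ρ D = (((∑ j ∈ Finset.Ico 1 n, (2 * (S j).1 + t)) + D : ℝ) : EReal) := by
  classical
  have h : ∃ i, FindsAt S ρ D i := ⟨n, hn⟩
  have hfind : Nat.find h = n := (Nat.find_eq_iff h).2 ⟨hn, hlt⟩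
  rw [searchCost, dif_pos h]
  congr!

lemma exists_first {m : ℕ} {S : Strategy m} {ρ : Fin m} {D : ℝ} (h : ∃ i, FindsAt S ρ D i) :
    ∃ n, FindsAt S ρ D n ∧ ∀ j < n, ¬ FindsAt S ρ D j := by
  classical
  exact ⟨Nat.find h, Nat.find_spec h, fun j hj => Nat.find_min h hj⟩

lemma searchCost_div_le_competitiveCost {m : ℕ} {t lam : ℝ} (S : Strategy m) (ρ : Fin m) {D : ℝ}
    (hD : lam ≤ D) : searchCost t S ρ D / (D : EReal) ≤ competitiveCost t lam S :=
  le_iSup_of_le ρ (le_iSup_of_le D (le_iSup_of_le hD le_rfl))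

/-! ### Periodic strategies -/

lemma IsPeriodic.exists_ray_eq {m : ℕ} {S : Strategy m} (hS : IsPeriodic S) (ρ : Fin m) :
    ∃ j, 1 ≤ j ∧ j ≤ m ∧ (S j).2 = ρ := by
  have hinj : Function.Injective (fun k : Fin m => (S (k + 1)).2) := by
    intro a b hab
    have := hS.1 (a + 1) (b + 1) (by omega) (by omega) (by omega) (by omega) hab
    exact Fin.ext (by omega)
  obtain ⟨k, hk⟩ := (Finite.injective_iff_surjective.1 hinj) ρ
  exact ⟨k + 1, by omega, by omega, hk⟩

lemma IsPeriodic.ray_add_mul {m : ℕ} {S : Strategy m} (hS : IsPeriodic S) {j : ℕ} (hj : 1 ≤ j)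
    (k : ℕ) : (S (j + k * m)).2 = (S j).2 := by
  induction k with
  | zero => simp
  | succ k ih =>
    rw [← ih, ← hS.2 (j + k * m) (by omega)]
    congr 2
    ring

lemma IsPeriodic.exists_findsAt {m : ℕ} {S : Strategy m} (hm : 0 < m) (hS : IsPeriodic S)
    (hlim : Tendsto (fun i => (S i).1) atTop atTop) (ρ : Fin m) (D : ℝ) :
    ∃ i, FindsAt S ρ D i := by
  obtain ⟨j, hj1, -, hj⟩ := hS.exists_ray_eq ρ
  obtain ⟨N, hN⟩ := eventually_atTop.1 (hlim.eventually_ge_atTop D)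
  refine ⟨j + N * m, by omega, by rw [hS.ray_add_mul hj1, hj], hN _ ?_⟩
  exact (Nat.le_mul_of_pos_right N hm).trans (Nat.le_add_left _ _)

lemma IsPeriodic.isSearchStrategy {m : ℕ} {S : Strategy m} (hm : 0 < m) (hS : IsPeriodic S)
    (hnonneg : ∀ i, 1 ≤ i → 0 ≤ (S i).1) (hlim : Tendsto (fun i => (S i).1) atTop atTop) :
    IsSearchStrategy S := by
  refine ⟨hnonneg, fun ρ => not_bddAbove_iff.2 fun B => ?_⟩
  obtain ⟨i, hi, hρ, hB⟩ := hS.exists_findsAt hm hlim ρ (B + 1)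
  exact ⟨(S i).1, ⟨i, hi, hρ, rfl⟩, by linarith⟩

/-- If all the worst-case ratios of a periodic strategy agree, where the initial distance `lam` is
regarded as the turning point with number `0`, then their common value is the competitive cost. -/
lemma IsPeriodic.competitiveCost_eq {m : ℕ} {t lam K : ℝ} {S : Strategy m} (hm : 0 < m)
    (ht : 0 ≤ t) (hlam : 0 < lam) (hS : IsPeriodic S) {x : ℕ → ℝ} (hx0 : x 0 = lam)
    (hSx : ∀ i, 1 ≤ i → (S i).1 = x i) (hx : ∀ i, lam ≤ x i) (hlim : Tendsto x atTop atTop)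
    (hsum : ∀ k, ∑ j ∈ Finset.Ico 1 (m + k), (2 * x j + t) = 2 * K * x k) :
    IsSearchStrategy S ∧ competitiveCost t lam S = ((1 + 2 * K : ℝ) : EReal) := by
  have hlimS : Tendsto (fun i => (S i).1) atTop atTop :=
    hlim.congr' (eventually_atTop.2 ⟨1, fun i hi => (hSx i hi).symm⟩)
  have hsumS : ∀ n, ∑ j ∈ Finset.Ico 1 n, (2 * (S j).1 + t) =
      ∑ j ∈ Finset.Ico 1 n, (2 * x j + t) := fun n =>
    Finset.sum_congr rfl fun j hj => by rw [hSx j (Finset.mem_Ico.1 hj).1]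
  have hterm : ∀ j, 0 ≤ 2 * x j + t := fun j => by linarith [hx j]
  have hK : 0 ≤ K := by
    have h0 : 0 ≤ 2 * K * x 0 := hsum 0 ▸ Finset.sum_nonneg fun j _ => hterm j
    rw [hx0] at h0
    have := nonneg_of_mul_nonneg_left h0 hlam
    linarith
  refine ⟨hS.isSearchStrategy hm (fun i hi => hSx i hi ▸ hlam.le.trans (hx i)) hlimS,
    le_antisymm ?_ ?_⟩
  · refine iSup_le fun ρ => iSup_le fun D => iSup_le fun hD => ?_
    have hD0 : 0 < D := hlam.trans_le hD
    obtain ⟨n, hn, hfirst⟩ := exists_first (hS.exists_findsAt hm hlimS ρ D)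
    rw [searchCost_eq_of_first hn hfirst, ← EReal.coe_div, EReal.coe_le_coe_iff, div_le_iff₀ hD0,
      hsumS]
    suffices h : ∑ j ∈ Finset.Ico 1 n, (2 * x j + t) ≤ 2 * K * D by linarith
    rcases le_or_gt n m with hnm | hnm
    · calc ∑ j ∈ Finset.Ico 1 n, (2 * x j + t)
          ≤ ∑ j ∈ Finset.Ico 1 (m + 0), (2 * x j + t) :=
            Finset.sum_le_sum_of_subset_of_nonneg (Finset.Ico_subset_Ico_right hnm)
              fun j _ _ => hterm j
        _ = 2 * K * lam := by rw [hsum, hx0]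
        _ ≤ 2 * K * D := by gcongr
    · obtain ⟨k, rfl⟩ := Nat.exists_eq_add_of_lt hnm
      -- Step `k + 1` is the previous visit to the ray of step `m + k + 1`, and it missed the
      -- target.
      have hk : x (k + 1) < D := by
        by_contra! hcon
        refine hfirst (k + 1) (by omega) ⟨by omega, ?_, by rwa [hSx _ (by omega)]⟩
        rw [← hn.2.1, ← hS.2 (k + 1) (by omega)]
        congr 2
        ring
      rw [add_assoc, hsum]
      gcongr
  -- The supremum is attained at distance `lam` on the ray visited last in the first cycle.
  · have hfind : FindsAt S (S m).2 lam m := ⟨hm, rfl, by rw [hSx m hm]; exact hx m⟩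
    have hfirst : ∀ j < m, ¬ FindsAt S (S m).2 lam j := fun j hj h =>
      hj.ne (hS.1 j m h.1 hj.le hm le_rfl h.2.1)
    have hle := searchCost_div_le_competitiveCost (t := t) S (S m).2 (le_refl lam)
    rw [searchCost_eq_of_first hfind hfirst, ← EReal.coe_div, hsumS] at hle
    refine le_trans (le_of_eq ?_) hle
    have := hsum 0
    rw [add_zero, hx0] at this
    rw [this]
    congr 1
    field_simp
    ring

/-! ### The lower bound for arbitrary strategies -/

/-- The distance up to which each ray is known to hold no target at distance at least `lam`,
after the first `i` steps. -/
noncomputable def frontier {m : ℕ} (lam : ℝ) (S : Strategy m) : ℕ → Fin m → ℝ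
  | 0 => fun _ => lam
  | i + 1 => Function.update (frontier lam S i) (S (i + 1)).2
      (max (frontier lam S i (S (i + 1)).2) (S (i + 1)).1)

/-- The sum of the first `i` turning distances. -/
noncomputable def totalDepth {m : ℕ} (S : Strategy m) (i : ℕ) : ℝ :=
  ∑ j ∈ Finset.Ico 1 (i + 1), (S j).1

lemma totalDepth_succ {m : ℕ} (S : Strategy m) (i : ℕ) :
    totalDepth S (i + 1) = totalDepth S i + (S (i + 1)).1 := by
  rw [totalDepth, Finset.sum_Ico_succ_top (by omega), totalDepth]

lemma totalDepth_nonneg {m : ℕ} {S : Strategy m} (hS : IsSearchStrategy S) (i : ℕ) :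
    0 ≤ totalDepth S i :=
  Finset.sum_nonneg fun j hj => hS.1 j (Finset.mem_Ico.1 hj).1

lemma totalDepth_monotone {m : ℕ} {S : Strategy m} (hS : IsSearchStrategy S) :
    Monotone (totalDepth S) :=
  monotone_nat_of_le_succ fun i => by
    rw [totalDepth_succ]
    linarith [hS.1 (i + 1) (by omega)]

/-- Early distances may all be zero, so dividing by `totalDepth` is meaningful only from some step
on. -/
lemma exists_totalDepth_pos {m : ℕ} {S : Strategy m} (hm : 0 < m) (hS : IsSearchStrategy S) :
    ∃ N, ∀ i, N ≤ i → 0 < totalDepth S i := by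
  obtain ⟨_, ⟨i, hi, -, rfl⟩, hpos⟩ := not_bddAbove_iff.1 (hS.2 ⟨0, hm⟩) 0
  obtain ⟨k, rfl⟩ := Nat.exists_eq_add_of_le' hi
  refine ⟨k + 1, fun j hj => lt_of_lt_of_le ?_ (totalDepth_monotone hS hj)⟩
  rw [totalDepth_succ]
  linarith [totalDepth_nonneg hS k]

lemma frontier_monotone {m : ℕ} (lam : ℝ) (S : Strategy m) : Monotone (frontier lam S) :=
  monotone_nat_of_le_succ fun i => by
    rw [frontier, le_update_iff]
    exact ⟨le_max_left _ _, fun _ _ => le_rfl⟩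

lemma le_frontier {m : ℕ} (lam : ℝ) (S : Strategy m) (i : ℕ) (ρ : Fin m) :
    lam ≤ frontier lam S i ρ :=
  frontier_monotone lam S (Nat.zero_le i) ρ

lemma depth_le_frontier {m : ℕ} (lam : ℝ) (S : Strategy m) {i j : ℕ} (hj : 1 ≤ j) (hji : j ≤ i) :
    (S j).1 ≤ frontier lam S i (S j).2 := by
  refine le_trans ?_ (frontier_monotone lam S hji (S j).2)
  obtain ⟨k, rfl⟩ := Nat.exists_eq_add_of_le' hj
  simp [frontier]

/-- A target just beyond the frontier of any ray is still unfound, so the competitive cost bounds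
the distance travelled so far by every frontier. -/
lemma totalDepth_le_mul_frontier {m : ℕ} {t lam c : ℝ} {S : Strategy m} (ht : 0 ≤ t)
    (hlam : 0 < lam) (hS : IsSearchStrategy S)
    (hc : competitiveCost t lam S ≤ ((1 + 2 * c : ℝ) : EReal)) (i : ℕ) (ρ : Fin m) :
    totalDepth S i ≤ c * frontier lam S i ρ := by
  have key : ∀ D, frontier lam S i ρ < D → totalDepth S i ≤ c * D := by
    intro D hD
    have hlD : lam < D := (le_frontier lam S i ρ).trans_lt hD
    have hD0 : 0 < D := hlam.trans hlD
    have hex : ∃ k, FindsAt S ρ D k := by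
      obtain ⟨_, ⟨k, hk, hρ, rfl⟩, hlt⟩ := not_bddAbove_iff.1 (hS.2 ρ) D
      exact ⟨k, hk, hρ, hlt.le⟩
    obtain ⟨n, hn, hfirst⟩ := exists_first hex
    have hle := (searchCost_div_le_competitiveCost (t := t) S ρ hlD.le).trans hc
    rw [searchCost_eq_of_first hn hfirst, ← EReal.coe_div, EReal.coe_le_coe_iff,
      div_le_iff₀ hD0] at hle
    have hin : i + 1 ≤ n := by
      by_contra! hcon
      have := depth_le_frontier lam S hn.1 (Nat.lt_succ_iff.1 hcon)
      rw [hn.2.1] at this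
      linarith [hn.2.2]
    have h2 : 2 * totalDepth S i ≤ ∑ j ∈ Finset.Ico 1 n, (2 * (S j).1 + t) := by
      rw [totalDepth, Finset.mul_sum]
      calc ∑ j ∈ Finset.Ico 1 (i + 1), 2 * (S j).1
          ≤ ∑ j ∈ Finset.Ico 1 (i + 1), (2 * (S j).1 + t) :=
            Finset.sum_le_sum fun j _ => by linarith
        _ ≤ _ := Finset.sum_le_sum_of_subset_of_nonneg (Finset.Ico_subset_Ico_right hin)
            fun j hj _ => by linarith [hS.1 j (Finset.mem_Ico.1 hj).1]
    linarith
  -- A target exactly at the frontier may already be found, so the bound there comes from letting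
  -- `D` decrease to it.
  have hlim : Tendsto (fun D => c * D) (𝓝[>] frontier lam S i ρ) (𝓝 (c * frontier lam S i ρ)) :=
    ((continuous_const.mul continuous_id).tendsto _).mono_left nhdsWithin_le_nhds
  exact ge_of_tendsto hlim (eventually_nhdsWithin_of_forall fun D hD => key D hD)

lemma frequently_frontier_lt {m : ℕ} (hm : 0 < m) (lam : ℝ) {S : Strategy m}
    (hS : IsSearchStrategy S) :
    ∃ᶠ i in atTop, frontier lam S i (S (i + 1)).2 < (S (i + 1)).1 := by
  refine frequently_atTop.2 fun N => ?_
  by_contra! hcon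
  have hconst : ∀ i, N ≤ i → frontier lam S i = frontier lam S N := fun i hi => by
    induction i, hi using Nat.le_induction with
    | base => rfl
    | succ i hi ih => rw [frontier, max_eq_left (hcon i hi), Function.update_eq_self, ih]
  refine hS.2 ⟨0, hm⟩ ⟨frontier lam S N ⟨0, hm⟩, ?_⟩
  rintro _ ⟨i, hi, hρ, rfl⟩
  have := depth_le_frontier lam S hi (le_max_left i N)
  rwa [hconst _ (le_max_right i N), hρ] at this

/-- The weighted inequality between arithmetic and geometric means of `x` and `n` copies of
`T / n`. -/
lemma mul_pow_mul_le_add_pow_mul {n : ℕ} (hn : 0 < n) {x T : ℝ} (hx : 0 ≤ x) (hT : 0 < T) :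
    x * T ^ n * ((n : ℝ) + 1) ^ (n + 1) ≤ (T + x) ^ (n + 1) * (n : ℝ) ^ n := by
  have hn' : (0 : ℝ) < n := by exact_mod_cast hn
  -- Bernoulli's inequality is applied to `1 + y`, the arithmetic mean of `x` and `n` copies of `T /
  -- n`, divided by `T / n`.
  have ha : (-2 : ℝ) ≤ (x / T * n - 1) / (n + 1) := by
    rw [le_div_iff₀ (by positivity)]
    have : 0 ≤ x / T * n := by positivity
    linarith
  have h := one_add_mul_le_pow ha (n + 1)
  have h1 : 1 + ((n + 1 : ℕ) : ℝ) * ((x / T * n - 1) / (n + 1)) = x * n / T := by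
    push_cast
    field_simp
    ring
  have h2 : 1 + (x / T * n - 1) / (n + 1) = (T + x) * n / (T * (n + 1)) := by
    field_simp
    ring
  rw [h1, h2, div_pow, div_le_div_iff₀ hT (by positivity), mul_pow, mul_pow] at h
  have hpos : 0 < n * T := by positivity
  refine le_of_mul_le_mul_right ?_ hpos
  calc x * T ^ n * ((n : ℝ) + 1) ^ (n + 1) * (n * T)
      = x * n * (T ^ (n + 1) * ((n : ℝ) + 1) ^ (n + 1)) := by ring
    _ ≤ (T + x) ^ (n + 1) * (n : ℝ) ^ (n + 1) * T := h
    _ = _ := by ring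

/-- The product of the frontiers relative to the distance travelled. -/
noncomputable def potential {m : ℕ} (lam : ℝ) (S : Strategy m) (i : ℕ) : ℝ :=
  (∏ ρ, frontier lam S i ρ) / totalDepth S i ^ m

lemma exists_potential_eq {m : ℕ} {lam : ℝ} (hlam : 0 < lam) (S : Strategy m) (i : ℕ) :
    ∃ R, 0 < R ∧
      potential lam S i = frontier lam S i (S (i + 1)).2 * R / totalDepth S i ^ m ∧
      potential lam S (i + 1) =
        max (frontier lam S i (S (i + 1)).2) (S (i + 1)).1 * R / totalDepth S (i + 1) ^ m := by
  refine ⟨∏ ρ ∈ Finset.univ \ {(S (i + 1)).2}, frontier lam S i ρ,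
    Finset.prod_pos fun ρ _ => hlam.trans_le (le_frontier lam S i ρ), ?_, ?_⟩
  · rw [potential, Finset.prod_eq_mul_prod_sdiff_singleton_of_mem (Finset.mem_univ (S (i + 1)).2)]
  · rw [potential, frontier, Finset.prod_update_of_mem (Finset.mem_univ _)]

lemma potential_succ_le {m : ℕ} {lam : ℝ} {S : Strategy m} (hlam : 0 < lam)
    (hS : IsSearchStrategy S) {i : ℕ} (hpos : 0 < totalDepth S i)
    (h : (S (i + 1)).1 ≤ frontier lam S i (S (i + 1)).2) :
    potential lam S (i + 1) ≤ potential lam S i := by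
  obtain ⟨R, hR, h1, h2⟩ := exists_potential_eq hlam S i
  have hf := hlam.trans_le (le_frontier lam S i (S (i + 1)).2)
  rw [h1, h2, max_eq_left h]
  gcongr
  exact totalDepth_monotone hS i.le_succ

/-- Advancing a frontier from `f` to `x` multiplies the potential by `(x / f) (T / (T + x))^(n+1)`.
Here `1 / f ≤ c / T`, and AM-GM bounds what remains uniformly in `x`. -/
lemma potential_succ_le_mul {n : ℕ} {lam c : ℝ} {S : Strategy (n + 1)} (hn : 0 < n)
    (hlam : 0 < lam) (hS : IsSearchStrategy S) {i : ℕ} (hpos : 0 < totalDepth S i)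
    (hc : totalDepth S i ≤ c * frontier lam S i (S (i + 1)).2)
    (h : frontier lam S i (S (i + 1)).2 < (S (i + 1)).1) :
    potential lam S (i + 1) ≤
      c * ((n : ℝ) ^ n / ((n : ℝ) + 1) ^ (n + 1)) * potential lam S i := by
  obtain ⟨R, hR, h1, h2⟩ := exists_potential_eq hlam S i
  have hf := hlam.trans_le (le_frontier lam S i (S (i + 1)).2)
  have hx := hS.1 (i + 1) (by omega)
  rw [h1, h2, max_eq_right h.le, totalDepth_succ]
  generalize frontier lam S i (S (i + 1)).2 = f at *
  generalize totalDepth S i = T at *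
  generalize (S (i + 1)).1 = x at *
  have hn' : (0 : ℝ) < n := by exact_mod_cast hn
  have key := mul_pow_mul_le_add_pow_mul hn hx hpos
  have hcf : 0 < c * f := hpos.trans_le hc
  have hTx : 0 < T + x := by linarith
  rw [show c * ((n : ℝ) ^ n / ((n : ℝ) + 1) ^ (n + 1)) * (f * R / T ^ (n + 1)) =
    c * f * n ^ n * R / (((n : ℝ) + 1) ^ (n + 1) * T ^ (n + 1)) by field_simp,
    div_le_div_iff₀ (by positivity) (by positivity)]
  calc x * R * (((n : ℝ) + 1) ^ (n + 1) * T ^ (n + 1))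
      = R * T * (x * T ^ n * ((n : ℝ) + 1) ^ (n + 1)) := by ring
    _ ≤ R * (c * f) * ((T + x) ^ (n + 1) * (n : ℝ) ^ n) := by gcongr
    _ = _ := by ring

lemma le_potential {m : ℕ} {lam c : ℝ} {S : Strategy m} {i : ℕ} (hc : 0 < c)
    (hpos : 0 < totalDepth S i) (hle : ∀ ρ, totalDepth S i ≤ c * frontier lam S i ρ) :
    1 / c ^ m ≤ potential lam S i := by
  rw [potential, div_le_div_iff₀ (by positivity) (by positivity), one_mul]
  calc totalDepth S i ^ m = ∏ _ρ : Fin m, totalDepth S i := by simp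
    _ ≤ ∏ ρ, c * frontier lam S i ρ := Finset.prod_le_prod (fun _ _ => hpos.le) fun ρ _ => hle ρ
    _ = _ := by rw [Finset.prod_mul_distrib]; simp [mul_comm]

/-- No search strategy on `n + 1` rays has a smaller competitive cost than the optimal one for
turn cost zero. -/
lemma le_competitiveCost {n : ℕ} (hn : 0 < n) {t lam : ℝ} (ht : 0 ≤ t) (hlam : 0 < lam)
    {S : Strategy (n + 1)} (hS : IsSearchStrategy S) :
    ((1 + 2 * (((n : ℝ) + 1) ^ (n + 1) / (n : ℝ) ^ n) : ℝ) : EReal) ≤ competitiveCost t lam S := by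
  by_contra! hlt
  -- A real number strictly in between makes the contraction factor `δ` strictly less than `1`.
  obtain ⟨r, hr1, hr2⟩ := EReal.lt_iff_exists_real_btwn.1 hlt
  have hn' : (0 : ℝ) < n := by exact_mod_cast hn
  obtain ⟨c, rfl⟩ : ∃ c, r = 1 + 2 * c := ⟨(r - 1) / 2, by ring⟩
  have hcC : c < ((n : ℝ) + 1) ^ (n + 1) / (n : ℝ) ^ n := by
    have := EReal.coe_lt_coe_iff.1 hr2
    linarith
  have hle := totalDepth_le_mul_frontier ht hlam hS hr1.le
  obtain ⟨N, hN⟩ := exists_totalDepth_pos n.succ_pos hS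
  have hc : 0 < c :=
    pos_of_mul_pos_left ((hN N le_rfl).trans_le (hle N 0))
      (hlam.le.trans (le_frontier lam S N 0))
  set δ := c * ((n : ℝ) ^ n / ((n : ℝ) + 1) ^ (n + 1)) with hδ
  have hδ1 : δ < 1 := by
    rw [hδ, ← mul_div_assoc, div_lt_one (by positivity)]
    exact (lt_div_iff₀ (by positivity)).1 hcC
  have hlow : ∀ i, N ≤ i → 1 / c ^ (n + 1) ≤ potential lam S i := fun i hi =>
    le_potential hc (hN i hi) (hle i)
  have hc' : 0 < 1 / c ^ (n + 1) := by positivity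
  have hanti : Antitone fun k => potential lam S (N + k) := antitone_nat_of_succ_le fun k => by
    have hpos := hN (N + k) (by omega)
    rcases le_or_gt (S (N + k + 1)).1 (frontier lam S (N + k) (S (N + k + 1)).2) with h | h
    · exact potential_succ_le hlam hS hpos h
    · have := potential_succ_le_mul hn hlam hS hpos (hle _ _) h
      have := hlow (N + k) (by omega)
      rw [← add_assoc]
      nlinarith
  obtain ⟨L, hL⟩ : ∃ L, Tendsto (fun k => potential lam S (N + k)) atTop (𝓝 L) :=
    ⟨_, tendsto_atTop_ciInf hanti ⟨1 / c ^ (n + 1), by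
      rintro _ ⟨k, rfl⟩
      exact hlow _ (by omega)⟩⟩
  have hLpos : 0 < L := hc'.trans_le (ge_of_tendsto' hL fun k => hlow _ (by omega))
  have hL' : Tendsto (potential lam S) atTop (𝓝 L) := by
    rw [← tendsto_add_atTop_iff_nat N]
    simpa only [add_comm N] using hL
  -- The contraction holds only at infinitely many steps, which suffices since the whole potential
  -- converges.
  have hLδ : L ≤ δ * L := by
    refine le_of_tendsto_of_tendsto_of_frequently ((tendsto_add_atTop_iff_nat 1).2 hL')
      (hL'.const_mul δ) ?_
    refine ((frequently_frontier_lt n.succ_pos lam hS).and_eventually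
      (eventually_ge_atTop N)).mono fun i hi => ?_
    exact potential_succ_le_mul hn hlam hS (hN i hi.2) (hle _ _) hi.1
  nlinarith

/-! ### The two families of strategies -/

lemma sum_linear_mul_pow {n : ℕ} (hn : 0 < n) (a b : ℝ) {N : ℕ} (hN : 1 ≤ N) :
    ∑ j ∈ Finset.Ico 1 N, (a * j + b) * (((n : ℝ) + 1) / n) ^ j =
      n * (a * N + b - a * (n + 1)) * (((n : ℝ) + 1) / n) ^ N - (n + 1) * (b - a * n) := by
  have hn' : (0 : ℝ) < n := by exact_mod_cast hn
  induction N, hN using Nat.le_induction with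
  | base =>
    simp
    field_simp
    ring
  | succ N hN ih =>
    rw [Finset.sum_Ico_succ_top hN, ih, pow_succ]
    push_cast
    field_simp
    ring

lemma competitiveCost_linear_mul_pow {n : ℕ} (hn : 0 < n) {t lam s : ℝ} (ht : 0 ≤ t)
    (hlam : 0 < lam) (hs : s = t / (2 * lam)) {S : Strategy (n + 1)} (hS : IsPeriodic S)
    (hsmall : s ≤ 1 / ((((n : ℝ) + 1) / n) ^ n - 1))
    (hSx : ∀ i : ℕ, 1 ≤ i → (S i).1 =
      ((1 / (n : ℝ) * (1 - ((((n : ℝ) + 1) / n) ^ n - 1) * s) * i + (1 + s)) *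
        (((n : ℝ) + 1) / n) ^ i - s) * lam) :
    IsSearchStrategy S ∧
      competitiveCost t lam S =
        ((1 + 2 * (((n : ℝ) + 1) ^ (n + 1) / (n : ℝ) ^ n) : ℝ) : EReal) := by
  have hn' : (0 : ℝ) < n := by exact_mod_cast hn
  have hts : t = 2 * lam * s := by rw [hs]; field_simp
  have hs0 : 0 ≤ s := by rw [hs]; positivity
  set M : ℝ := ((n : ℝ) + 1) / n with hM
  have hM1 : 1 < M := by rw [hM, one_lt_div hn']; linarith
  have hQ : 0 < M ^ n - 1 := sub_pos.2 (one_lt_pow₀ hM1 hn.ne')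
  set a : ℝ := 1 / (n : ℝ) * (1 - (M ^ n - 1) * s) with ha
  -- The threshold on `s` says exactly that the slope `a` is non-negative, which keeps the distances
  -- above `lam`.
  have ha0 : 0 ≤ a := by
    have := (le_div_iff₀ hQ).1 hsmall
    exact mul_nonneg (by positivity) (by linarith)
  have han : a * n = 1 - (M ^ n - 1) * s := by rw [ha]; field_simp
  have hlow : ∀ i : ℕ, (1 + s) * M ^ i ≤ (a * i + (1 + s)) * M ^ i := fun i => by
    have : 0 ≤ a * i := by positivity
    exact mul_le_mul_of_nonneg_right (by linarith) (by positivity)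
  refine hS.competitiveCost_eq (x := fun i => ((a * i + (1 + s)) * M ^ i - s) * lam)
    n.succ_pos ht hlam (by simp) hSx (fun i => ?_) ?_ fun k => ?_
  · have h1 : 1 ≤ M ^ i := one_le_pow₀ hM1.le
    nlinarith [hlow i]
  · have hlim : Tendsto (fun i : ℕ => ((1 + s) * M ^ i - s) * lam) atTop atTop :=
      ((tendsto_atTop_add_const_right _ (-s)
        ((tendsto_pow_atTop_atTop_of_one_lt hM1).const_mul_atTop (by linarith))).atTop_mul_const
          hlam)
    refine tendsto_atTop_mono (fun i => ?_) hlim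
    have := hlow i
    gcongr
  · have hterm : ∀ j : ℕ, 2 * (((a * j + (1 + s)) * M ^ j - s) * lam) + t =
        2 * lam * ((a * j + (1 + s)) * M ^ j) := fun j => by rw [hts]; ring
    simp only [hterm]
    -- The slope is chosen so that `(1 + s) - a * n = s * M ^ n`, which matches the constant term of
    -- the sum with `-K s`.
    rw [← Finset.mul_sum, sum_linear_mul_pow hn _ _ (by omega), ← hM, han]
    have hMn : ((n : ℝ) + 1) ^ (n + 1) / (n : ℝ) ^ n = (n + 1) * M ^ n := by
      rw [hM, div_pow, pow_succ]
      ring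
    have hnM : (n : ℝ) * M = n + 1 := by rw [hM]; field_simp
    rw [hMn, pow_add, pow_succ]
    push_cast
    linear_combination 2 * lam * (a * k + (1 + s)) * M ^ n * M ^ k * hnM

/-- The terms `2 x_j + t` are purely geometric. Matching the sum with `2K x_k` forces `K = q^(n+1) /
(q - 1)` from the `q^k` terms and `s * q^n = 1 + s` from the constants. -/
lemma competitiveCost_geometric {n : ℕ} (hn : 0 < n) {t lam s q : ℝ} (ht : 0 ≤ t)
    (hlam : 0 < lam) (hs : s = t / (2 * lam)) (hs0 : 0 < s) (hq : 1 < q)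
    (hqn : q ^ n = 1 + s⁻¹) {S : Strategy (n + 1)} (hS : IsPeriodic S)
    (hSx : ∀ i : ℕ, 1 ≤ i → (S i).1 = ((1 + s) * q ^ i - s) * lam) :
    IsSearchStrategy S ∧
      competitiveCost t lam S = ((1 + 2 * (q / (q - 1) * (1 + s⁻¹)) : ℝ) : EReal) := by
  have hts : t = 2 * lam * s := by rw [hs]; field_simp
  have hq1 : q - 1 ≠ 0 := (sub_pos.2 hq).ne'
  refine hS.competitiveCost_eq (x := fun i => ((1 + s) * q ^ i - s) * lam)
    n.succ_pos ht hlam (by simp) hSx (fun i => ?_) ?_ fun k => ?_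
  · have h1 : 1 ≤ q ^ i := one_le_pow₀ hq.le
    have : (1 + s) * 1 ≤ (1 + s) * q ^ i := by gcongr
    nlinarith
  · exact ((tendsto_atTop_add_const_right _ (-s)
        ((tendsto_pow_atTop_atTop_of_one_lt hq).const_mul_atTop (by linarith))).atTop_mul_const
          hlam)
  · have hterm : ∀ j : ℕ, 2 * (((1 + s) * q ^ j - s) * lam) + t =
        2 * lam * (1 + s) * q ^ j := fun j => by rw [hts]; ring
    simp only [hterm]
    rw [← Finset.mul_sum, geom_sum_Ico hq.ne' (by omega), pow_add, pow_succ, hqn]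
    field_simp
    ring

end RaySearch

theorem theorem6 (m : ℕ) (hm : 2 ≤ m) (t lam : ℝ) (ht : 0 ≤ t) (hlam : 0 < lam)
    (S : RaySearch.Strategy m) (hS : RaySearch.IsPeriodic S) :
    (t / (2 * lam) ≤ 1 / (((m : ℝ) / ((m : ℝ) - 1)) ^ (m - 1) - 1) →
      (∀ i : ℕ, 1 ≤ i → (S i).1 =
        ((1 / ((m : ℝ) - 1) *
              (1 - (((m : ℝ) / ((m : ℝ) - 1)) ^ (m - 1) - 1) * (t / (2 * lam))) * (i : ℝ)
            + (1 + t / (2 * lam))) * ((m : ℝ) / ((m : ℝ) - 1)) ^ i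
          - t / (2 * lam)) * lam) →
      RaySearch.IsOptimal t lam S ∧
        RaySearch.competitiveCost t lam S =
          ((1 + 2 * ((m : ℝ) ^ m / ((m : ℝ) - 1) ^ (m - 1)) : ℝ) : EReal)) ∧
    (1 / (((m : ℝ) / ((m : ℝ) - 1)) ^ (m - 1) - 1) ≤ t / (2 * lam) →
      (∀ i : ℕ, 1 ≤ i → (S i).1 =
        ((1 + t / (2 * lam)) * (1 + (t / (2 * lam))⁻¹) ^ ((i : ℝ) / ((m : ℝ) - 1))
          - t / (2 * lam)) * lam) →
      RaySearch.IsSearchStrategy S ∧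
        RaySearch.competitiveCost t lam S =
          ((((1 + (t / (2 * lam))⁻¹) ^ ((-1 : ℝ) / ((m : ℝ) - 1))
              - (3 + 2 * (t / (2 * lam))⁻¹)) /
            ((1 + (t / (2 * lam))⁻¹) ^ ((-1 : ℝ) / ((m : ℝ) - 1)) - 1) : ℝ) : EReal)) := by
  obtain ⟨n, rfl⟩ : ∃ n, m = n + 1 := ⟨m - 1, by omega⟩
  have hn : 0 < n := by omega
  have hn' : (0 : ℝ) < n := by exact_mod_cast hn
  have hcast : ((n + 1 : ℕ) : ℝ) = (n : ℝ) + 1 := by push_cast; ring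
  simp only [hcast, add_sub_cancel_right, Nat.add_sub_cancel]
  obtain ⟨s, hs⟩ : ∃ s, s = t / (2 * lam) := ⟨_, rfl⟩
  rw [← hs]
  refine ⟨fun hsmall hSx => ?_, fun hlarge hSx => ?_⟩
  · obtain ⟨hstrat, hcost⟩ :=
      RaySearch.competitiveCost_linear_mul_pow hn ht hlam hs hS hsmall hSx
    exact ⟨⟨hstrat, fun S' hS' => hcost ▸ RaySearch.le_competitiveCost hn ht hlam hS'⟩, hcost⟩
  · have hM1 : 1 < ((n : ℝ) + 1) / n := by rw [one_lt_div hn']; linarith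
    have hs0 : 0 < s :=
      (one_div_pos.2 (sub_pos.2 (one_lt_pow₀ hM1 hn.ne'))).trans_le hlarge
    have hB : 1 < 1 + s⁻¹ := by linarith [inv_pos.2 hs0]
    have hB0 : 0 ≤ 1 + s⁻¹ := by linarith
    obtain ⟨q, hq⟩ : ∃ q, q = (1 + s⁻¹) ^ ((1 : ℝ) / n) := ⟨_, rfl⟩
    have hq1 : 1 < q := hq ▸ Real.one_lt_rpow hB (by positivity)
    have hqpow : ∀ i : ℕ, (1 + s⁻¹) ^ ((i : ℝ) / n) = q ^ i := fun i => by
      rw [hq, ← Real.rpow_natCast, ← Real.rpow_mul hB0]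
      congr 1
      ring
    have hqn : q ^ n = 1 + s⁻¹ := by rw [← hqpow, div_self hn'.ne', Real.rpow_one]
    have hqinv : (1 + s⁻¹) ^ ((-1 : ℝ) / n) = q⁻¹ := by
      rw [hq, ← Real.rpow_neg hB0]
      congr 1
      ring
    obtain ⟨hstrat, hcost⟩ := RaySearch.competitiveCost_geometric hn ht hlam hs hs0 hq1 hqn hS
      fun i hi => by rw [hSx i hi, hqpow]
    refine ⟨hstrat, hcost.trans ?_⟩
    rw [hqinv]
    congr 1
    have h1 : q - 1 ≠ 0 := (sub_pos.2 hq1).ne'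
    have h2 : q⁻¹ - 1 ≠ 0 := (sub_neg.2 (inv_lt_one_of_one_lt₀ hq1)).ne
    have h3 : 1 - q ≠ 0 := (sub_neg.2 hq1).ne
    rw [eq_div_iff h2]
    field_simp
    ring
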